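/- Let $\phi:[0,\infty)\to[0,\infty)$ be convex, non-decreasing, of class $\mathcal C^2$ on $(0,\infty)$, with $\phi(0)=0$ and $\phi\not\equiv 0$; for $y>0$ let $\phi^{-1}(y)$ be the unique $x\ge 0$ with $\phi(x)=y$. For an integer $n\ge 1$ let $\nu_{n,\phi}$ be the probability measure on $[0,\infty)$ with density proportional to $r^{n-1}e^{-\phi(r)}$. For a Borel set $A$ put $A_\varepsilon=\{x: d(x,A)\le\varepsilon\}$ and $\nu^+(\partial A)=\liminf_{\varepsilon\to0^+}\frac{\nu(A_\varepsilon)-\nu(A)}{\varepsilon}$, and let $\mathrm{Is}_\nu$ be the largest function on $[0,1]$ such that $\nu^+(\partial A)\ge \mathrm{Is}_\nu(\nu(A))$ for all Borel sets $A$, i.e. $\mathrm{Is}_\nu(a)=\inf\{\nu^+(\partial A): A \text{ Borel},\ \nu(A)=a\}$. There exists a universal constant $C>0$ such that for every integer $n\ge1$, every $a\in[0,\tfrac12]$ and every function $\phi$ as above: (i) if (H1) $x\mapsto\sqrt{\phi(x)}/x$ is non-increasing on $(0,\infty)$, then $$\mathrm{Is}_{\nu_{n,\phi}}(a)\ \ge\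 C\,\frac{\sqrt n}{\phi^{-1}(n)}\,\phi^{-1}(1)\,\frac{a\log\frac1a}{\phi^{-1}\left(\log\frac1a\right)};$$ (ii) if (H2) $x\mapsto\sqrt{\phi(x)}/x$ is non-decreasing on $(0,\infty)$, then $$\mathrm{Is}_{\nu_{n,\phi}}(a)\ \ge\ C\,\frac{\sqrt n}{\phi^{-1}(n)}\,a\sqrt{\log\tfrac1a}.$$ At $a=0$ both right-hand sides are read as $0$. -/

import Mathlib

open MeasureTheory Set Filter Topology
open scoped ENNReal

/-- The boundary measure (lower outer Minkowski content) of `A`: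
`liminf_{ε → 0⁺} (μ(A_ε) - μ(A)) / ε`, where `A_ε = {x | d(x, A) ≤ ε}` is the closed
`ε`-neighbourhood (`Metric.cthickening ε A`). -/
noncomputable def boundaryMeasure {X : Type*} [PseudoEMetricSpace X] [MeasurableSpace X]
    (μ : Measure X) (A : Set X) : ℝ≥0∞ :=
  liminf (fun ε : ℝ => (μ (Metric.cthickening ε A) - μ A) / ENNReal.ofReal ε) (𝓝[>] 0)

/-- The isoperimetric function of `μ`: the largest function `I` with `I (μ A) ≤ μ⁺(∂A)` for all
Borel sets `A`, i.e. the infimum of the boundary measures of the Borel sets of measure `a`. -/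
noncomputable def isoperimetricFunction {X : Type*} [PseudoEMetricSpace X] [MeasurableSpace X]
    (μ : Measure X) (a : ℝ≥0∞) : ℝ≥0∞ :=
  ⨅ (A : Set X) (_ : MeasurableSet A) (_ : μ A = a), boundaryMeasure μ A

/-- The measure `r ^ (n - 1) * exp (-φ r) dr` on `[0, ∞)`, seen as a measure on `ℝ`. -/
noncomputable def unnormalizedRadialMeasure (n : ℕ) (φ : ℝ → ℝ) : Measure ℝ :=
  (volume.restrict (Ici (0 : ℝ))).withDensity
    (fun r => ENNReal.ofReal (r ^ (n - 1) * Real.exp (-φ r)))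

/-- The radial probability measure `ν_{n,φ}`, proportional to `r ^ (n - 1) * exp (-φ r) dr`
on `[0, ∞)`. -/
noncomputable def radialMeasure (n : ℕ) (φ : ℝ → ℝ) : Measure ℝ :=
  (unnormalizedRadialMeasure n φ univ)⁻¹ • unnormalizedRadialMeasure n φ

/-- `φ` maps `[0, ∞)` to `[0, ∞)`, is non-decreasing, convex, of class `C²`, and `φ 0 = 0`.
(The values of `φ` on the negative numbers play no role.) Smoothness is required on the open
half-line only, so that the powers `x ^ α`, `1 ≤ α`, are covered; continuity at `0` is automatic. -/
structure HypH0 (φ : ℝ → ℝ) : Prop where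
  mapsTo : MapsTo φ (Ici 0) (Ici 0)
  monotoneOn : MonotoneOn φ (Ici 0)
  convexOn : ConvexOn ℝ (Ici 0) φ
  contDiffOn : ContDiffOn ℝ 2 φ (Ioi 0)
  map_zero : φ 0 = 0

/-- `√φ(x) / x` is non-increasing. -/
structure HypH1 (φ : ℝ → ℝ) : Prop extends HypH0 φ where
  antitoneOn_sqrt_div : AntitoneOn (fun x => Real.sqrt (φ x) / x) (Ioi 0)

/-- `√φ(x) / x` is non-decreasing. -/
structure HypH2 (φ : ℝ → ℝ) : Prop extends HypH0 φ where
  monotoneOn_sqrt_div : MonotoneOn (fun x => Real.sqrt (φ x) / x) (Ioi 0)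

/-- The inverse `φ⁻¹(y)`, a point `x ∈ [0, ∞)` with `φ x = y`. If `φ` is convex, non-decreasing, not
identically zero on `[0, ∞)` and `φ 0 = 0`, this point exists and is unique for every `y > 0`. -/
noncomputable def phiInv (φ : ℝ → ℝ) (y : ℝ) : ℝ :=
  Function.invFunOn φ (Ici 0) y

/-! The density `r ^ m * exp (-φ r)`, `m = n - 1`, is log-concave, so the set where the normalized
density is at least `κ` is an interval. If its complement has mass at most `a / 2`, a Borel set of
measure `a ≤ 1 / 2` can neither avoid nor cover that interval; its closure then has a boundary point
inside, with a free side on which the density is at least `κ`, unless taking the closure already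
adds mass. So it suffices to find `[s, t]`, with density at least `κ` on it and tails of mass at
most `a / 4` each (`ofReal_le_isoperimetricFunction`).

By convexity of the potential `V = φ - m log`, a tail beyond `t` has normalized mass at most `κ /
k`, where `k` is a secant slope of `V` ending at `t`; thus `k ≥ 4 κ / a` is wanted. Put `R = φ⁻¹(n)`
and `L = log (1 / a)`. Around the mode `p`, `V` grows at least like `n z ^ 2 / (2 + z)`, `z = |r -
p| / R`, up to constants (`exists_mode`). This bounds the total mass by a multiple of the maximal
density times `R / √n`, so `D = V t - V p ≥ L / 2 + 2`. Within distance `8 R` of `p`, `D` also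
dominates `n z ^ 2`, and the geometric mean of both bounds gives slope of order `√(n L) / R`
(`mul_abs_sub_le`). Farther out `φ` beats the logarithm and the slope is at least `φ t / (2 t)`.
(H1) and (H2) enter only in checking that the claimed `κ` meets these two slope conditions. -/

/-! ### Boundary measure of sets on the line -/

/-- If for all small `ε` the closed `ε`-neighbourhood of `A` gains an interval of length `ε` inside
`[s, t]`, where `μ` has density at least `κ`, then the boundary measure of `A` is at least `κ`. -/
theorem ofReal_le_boundaryMeasure_of_eventually {μ : Measure ℝ} {A : Set ℝ}
    {s t κ : ℝ} (hfin : μ A ≠ ∞) (hcl : μ (closure A) = μ A)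
    (hd : ∀ x y, s ≤ x → x ≤ y → y ≤ t → ENNReal.ofReal (κ * (y - x)) ≤ μ (Ioo x y))
    (h : ∀ᶠ ε : ℝ in 𝓝[>] 0, ∃ u, s ≤ u ∧ u + ε ≤ t ∧ Ioo u (u + ε) ⊆ Metric.cthickening ε A ∧
      Disjoint (closure A) (Ioo u (u + ε))) :
    ENNReal.ofReal κ ≤ boundaryMeasure μ A := by
  refine le_liminf_of_le (by isBoundedDefault) ?_
  filter_upwards [h, self_mem_nhdsWithin] with ε hε hpos
  obtain ⟨u, hsu, hut, hsub, hdisj⟩ := hε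
  have hpos : (0 : ℝ) < ε := hpos
  rw [ENNReal.le_div_iff_mul_le (Or.inl (by simpa using hpos)) (Or.inl ENNReal.ofReal_ne_top),
    ← ENNReal.ofReal_mul' hpos.le]
  refine ENNReal.le_sub_of_add_le_right hfin ?_
  have h1 := hd u (u + ε) hsu (by linarith) hut
  rw [add_sub_cancel_left] at h1
  calc ENNReal.ofReal (κ * ε) + μ A ≤ μ (Ioo u (u + ε)) + μ (closure A) := by
        rw [hcl]; gcongr
    _ = μ (closure A ∪ Ioo u (u + ε)) := by
        rw [measure_union hdisj measurableSet_Ioo, add_comm]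
    _ ≤ μ (Metric.cthickening ε A) :=
        measure_mono (union_subset (Metric.closure_subset_cthickening _ _) hsub)

/-- A set with more mass than the complement of `[s, t]`, and whose complement also has more mass
than the complement of `[s, t]`, has a boundary point inside `[s, t]`; hence its boundary measure is
at least the minimal density there. -/
theorem ofReal_le_boundaryMeasure {μ : Measure ℝ} [IsFiniteMeasure μ] {A : Set ℝ} {s t κ : ℝ}
    (h1 : μ (Iio s) + μ (Ioi t) < μ A) (h2 : μ A + (μ (Iio s) + μ (Ioi t)) < μ univ)
    (hd : ∀ x y, s ≤ x → x ≤ y → y ≤ t → ENNReal.ofReal (κ * (y - x)) ≤ μ (Ioo x y)) :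
    ENNReal.ofReal κ ≤ boundaryMeasure μ A := by
  -- If the closure has larger mass, the numerator of the quotient stays bounded below and the
  -- quotient tends to infinity; otherwise `A` may be replaced by its closure.
  by_cases hcl : μ (closure A) = μ A
  · have hx : ∃ x ∈ closure A, x ∈ Icc s t := by
      by_contra! hcon
      refine absurd h1 (not_lt.2 ?_)
      refine (measure_mono fun x hx => ?_).trans (measure_union_le (Iio s) (Ioi t))
      have := hcon x (subset_closure hx)
      simp only [mem_Icc, not_and_or, not_le] at this
      exact this
    have hy : ∃ y ∈ Icc s t, y ∉ closure A := by
      by_contra! hcon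
      refine absurd h2 (not_lt.2 ?_)
      have : (univ : Set ℝ) ⊆ closure A ∪ (Iio s ∪ Ioi t) := fun x _ => by
        by_cases hx : x ∈ Icc s t
        · exact Or.inl (hcon x hx)
        · simp only [mem_Icc, not_and_or, not_le] at hx
          exact Or.inr hx
      rw [← hcl]
      exact (measure_mono this).trans ((measure_union_le _ _).trans
        (add_le_add le_rfl (measure_union_le _ _)))
    obtain ⟨x, hxA, hx⟩ := hx
    obtain ⟨y, hy, hyA⟩ := hy
    have hne : x ≠ y := fun h => hyA (h ▸ hxA)
    rcases lt_or_gt_of_ne hne with hxy | hxy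
    -- The last point `p` of the closure before `y` leaves `(p, y)` free, so each small enlargement
    -- gains `(p, p + ε)`.
    · have hK : IsCompact (closure A ∩ Icc x y) := isCompact_Icc.inter_left isClosed_closure
      obtain ⟨p, ⟨hpA, hpxy⟩, hmax⟩ := hK.exists_isGreatest ⟨x, hxA, left_mem_Icc.2 hxy.le⟩
      have hpy : p < y := lt_of_le_of_ne hpxy.2 fun h => hyA (h ▸ hpA)
      refine ofReal_le_boundaryMeasure_of_eventually (measure_ne_top _ _) hcl hd ?_
      filter_upwards [Ioo_mem_nhdsGT (sub_pos.2 hpy)] with ε hε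
      refine ⟨p, hx.1.trans hpxy.1, by linarith [hε.2, hy.2], fun z hz => ?_, ?_⟩
      · rw [← Metric.cthickening_closure]
        refine Metric.mem_cthickening_of_dist_le z p ε _ hpA ?_
        rw [Real.dist_eq, abs_le]
        constructor <;> linarith [hz.1, hz.2, hε.1]
      · rw [disjoint_left]
        intro z hzA hz
        have := hmax ⟨hzA, by linarith [hz.1, hpxy.1], by linarith [hz.2, hε.2]⟩
        exact absurd hz.1 (not_lt.2 this)
    · have hK : IsCompact (closure A ∩ Icc y x) := isCompact_Icc.inter_left isClosed_closure
      obtain ⟨p, ⟨hpA, hpxy⟩, hmin⟩ := hK.exists_isLeast ⟨x, hxA, right_mem_Icc.2 hxy.le⟩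
      have hpy : y < p := lt_of_le_of_ne hpxy.1 fun h => hyA (h ▸ hpA)
      refine ofReal_le_boundaryMeasure_of_eventually (measure_ne_top _ _) hcl hd ?_
      filter_upwards [Ioo_mem_nhdsGT (sub_pos.2 hpy)] with ε hε
      refine ⟨p - ε, by linarith [hε.2, hy.1], by linarith [hpxy.2, hx.2], fun z hz => ?_, ?_⟩
      · rw [← Metric.cthickening_closure]
        refine Metric.mem_cthickening_of_dist_le z p ε _ hpA ?_
        rw [Real.dist_eq, abs_le]
        constructor <;> linarith [hz.1, hz.2, hε.1]
      · rw [disjoint_left]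
        intro z hzA hz
        have := hmin ⟨hzA, by linarith [hz.1, hε.2], by linarith [hz.2, hpxy.2]⟩
        linarith [hz.2]
  · have hlt : μ A < μ (closure A) := lt_of_le_of_ne (measure_mono subset_closure) (Ne.symm hcl)
    have hd0 : μ (closure A) - μ A ≠ 0 := (tsub_pos_of_lt hlt).ne'
    refine le_liminf_of_le (by isBoundedDefault) ?_
    have hlim : Tendsto (fun ε : ℝ => ENNReal.ofReal (κ * ε)) (𝓝[>] 0) (𝓝 0) := by
      have : Tendsto (fun ε : ℝ => ENNReal.ofReal (κ * ε)) (𝓝 0) (𝓝 (ENNReal.ofReal (κ * 0))) :=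
        (ENNReal.continuous_ofReal.comp (continuous_const.mul continuous_id)).tendsto 0
      simpa using this.mono_left nhdsWithin_le_nhds
    filter_upwards [hlim.eventually_lt_const (pos_iff_ne_zero.2 hd0), self_mem_nhdsWithin]
      with ε hε hpos
    have hpos : (0 : ℝ) < ε := hpos
    rw [ENNReal.le_div_iff_mul_le (Or.inl (by simpa using hpos)) (Or.inl ENNReal.ofReal_ne_top),
      ← ENNReal.ofReal_mul' hpos.le]
    exact hε.le.trans (tsub_le_tsub_right
      (measure_mono (Metric.closure_subset_cthickening _ _)) _)

/-! ### Exponential tails and the radial measure -/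

theorem lintegral_Ioi_exp {k c : ℝ} (hk : 0 < k) (hc : 0 ≤ c) (t : ℝ) :
    ∫⁻ r in Ioi t, ENNReal.ofReal (c * Real.exp (-k * (r - t))) = ENNReal.ofReal (c / k) := by
  have he : (fun r => c * Real.exp (-k * (r - t)))
      = fun r => c * Real.exp (k * t) * Real.exp (-k * r) := by
    funext r
    rw [mul_assoc, ← Real.exp_add]
    ring_nf
  have hi : IntegrableOn (fun r => c * Real.exp (-k * (r - t))) (Ioi t) := by
    rw [he]
    exact (integrableOn_exp_mul_Ioi (by linarith) t).const_mul _
  rw [← ofReal_integral_eq_lintegral_ofReal hi (ae_of_all _ fun r => by positivity), he,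
    integral_const_mul, integral_exp_mul_Ioi (by linarith)]
  congr 1
  have : Real.exp (k * t) * Real.exp (-k * t) = 1 := by
    rw [← Real.exp_add]; simp
  rw [neg_mul] at this ⊢
  field_simp
  linear_combination c * this

theorem lintegral_Iic_exp {k c : ℝ} (hk : 0 < k) (hc : 0 ≤ c) (t : ℝ) :
    ∫⁻ r in Iic t, ENNReal.ofReal (c * Real.exp (-k * (t - r))) = ENNReal.ofReal (c / k) := by
  have he : (fun r => c * Real.exp (-k * (t - r)))
      = fun r => c * Real.exp (-k * t) * Real.exp (k * r) := by
    funext r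
    rw [mul_assoc, ← Real.exp_add]
    ring_nf
  have hi : IntegrableOn (fun r => c * Real.exp (-k * (t - r))) (Iic t) := by
    rw [he]
    exact (integrableOn_exp_mul_Iic hk t).const_mul _
  rw [← ofReal_integral_eq_lintegral_ofReal hi (ae_of_all _ fun r => by positivity), he,
    integral_const_mul, integral_exp_mul_Iic hk]
  congr 1
  have : Real.exp (-k * t) * Real.exp (k * t) = 1 := by
    rw [← Real.exp_add]; simp
  rw [neg_mul] at this ⊢
  field_simp
  linear_combination c * this

/-- The unnormalized radial density with exponent `m = n - 1`. -/
noncomputable def radialDensity (m : ℕ) (φ : ℝ → ℝ) (r : ℝ) : ℝ := r ^ m * Real.exp (-φ r)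

theorem unnormalizedRadialMeasure_apply (m : ℕ) (φ : ℝ → ℝ) {E : Set ℝ} (hE : MeasurableSet E) :
    unnormalizedRadialMeasure (m + 1) φ E
      = ∫⁻ r in E ∩ Ici 0, ENNReal.ofReal (radialDensity m φ r) := by
  rw [unnormalizedRadialMeasure, withDensity_apply _ hE, Measure.restrict_restrict hE]
  rfl

theorem unnormalizedRadialMeasure_le {m : ℕ} {φ : ℝ → ℝ} {E : Set ℝ} (hE : MeasurableSet E)
    {q : ℝ → ℝ} (hq : ∀ r ∈ E, 0 ≤ r → radialDensity m φ r ≤ q r) :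
    unnormalizedRadialMeasure (m + 1) φ E ≤ ∫⁻ r in E, ENNReal.ofReal (q r) := by
  rw [unnormalizedRadialMeasure_apply m φ hE]
  refine (setLIntegral_mono' (hE.inter measurableSet_Ici) fun r hr =>
    ENNReal.ofReal_le_ofReal (hq r hr.1 hr.2)).trans ?_
  exact lintegral_mono_set inter_subset_left

theorem ofReal_mul_sub_le_unnormalizedRadialMeasure_Ioo {m : ℕ} {φ : ℝ → ℝ} {x y c : ℝ}
    (hx : 0 ≤ x) (hc : 0 ≤ c) (h : ∀ r ∈ Ioo x y, c ≤ radialDensity m φ r) :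
    ENNReal.ofReal (c * (y - x)) ≤ unnormalizedRadialMeasure (m + 1) φ (Ioo x y) := by
  have hE : Ioo x y ∩ Ici 0 = Ioo x y :=
    inter_eq_left.2 fun r hr => hx.trans hr.1.le
  rw [unnormalizedRadialMeasure_apply m φ measurableSet_Ioo, hE, ENNReal.ofReal_mul hc,
    ← Real.volume_Ioo, ← setLIntegral_const]
  exact setLIntegral_mono' measurableSet_Ioo fun r hr => ENNReal.ofReal_le_ofReal (h r hr)

theorem radialMeasure_apply {n : ℕ} {φ : ℝ → ℝ} {Z : ℝ} (hZ : 0 < Z)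
    (h : unnormalizedRadialMeasure n φ univ = ENNReal.ofReal Z) (E : Set ℝ) :
    radialMeasure n φ E = ENNReal.ofReal Z⁻¹ * unnormalizedRadialMeasure n φ E := by
  rw [radialMeasure, h, Measure.smul_apply, smul_eq_mul, ENNReal.ofReal_inv_of_pos hZ]

/-! ### Convexity of `φ` and its inverse -/

namespace HypH0

variable {φ : ℝ → ℝ}

theorem nonneg (h : HypH0 φ) {x : ℝ} (hx : 0 ≤ x) : 0 ≤ φ x := h.mapsTo hx

/-- Convexity on the chord from the origin makes `φ x / x` non-decreasing; the product form also
covers `x = 0`. -/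
theorem mul_le_mul (h : HypH0 φ) {x y : ℝ} (hx : 0 ≤ x) (hxy : x ≤ y) : φ x * y ≤ φ y * x := by
  rcases hx.eq_or_lt with rfl | hx
  · simp [h.map_zero]
  have hy : 0 < y := hx.trans_le hxy
  have := h.convexOn.2 (mem_Ici.2 le_rfl) (mem_Ici.2 hy.le)
    (sub_nonneg.2 ((div_le_one hy).2 hxy)) (div_nonneg hx.le hy.le) (by ring)
  simp only [smul_eq_mul, mul_zero, zero_add, h.map_zero, div_mul_cancel₀ _ hy.ne'] at this
  calc φ x * y ≤ x / y * φ y * y := by gcongr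
    _ = φ y * x := by field_simp

theorem continuousOn (h : HypH0 φ) : ContinuousOn φ (Ici 0) := by
  intro x hx
  rcases (mem_Ici.1 hx).eq_or_lt with rfl | hx
  -- Smoothness says nothing at `0`; there `0 ≤ φ y ≤ φ 1 * y` squeezes.
  · have h1 : Tendsto (fun y : ℝ => φ 1 * y) (𝓝[Ici 0] 0) (𝓝 0) := by
      have : Tendsto (fun y : ℝ => φ 1 * y) (𝓝 0) (𝓝 (φ 1 * 0)) :=
        (continuous_const.mul continuous_id).tendsto 0
      rw [mul_zero] at this
      exact this.mono_left nhdsWithin_le_nhds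
    rw [ContinuousWithinAt, h.map_zero]
    refine tendsto_of_tendsto_of_tendsto_of_le_of_le' tendsto_const_nhds h1 ?_ ?_
    · filter_upwards [self_mem_nhdsWithin] with y hy using h.nonneg hy
    · filter_upwards [self_mem_nhdsWithin, mem_nhdsWithin_of_mem_nhds (Iio_mem_nhds one_pos)]
        with y hy hy1
      simpa using h.mul_le_mul hy (le_of_lt hy1)
  · exact (h.contDiffOn.continuousOn.continuousAt (Ioi_mem_nhds hx)).continuousWithinAt

theorem exists_eq (h : HypH0 φ) (hne : ∃ x : ℝ, 0 ≤ x ∧ φ x ≠ 0) {y : ℝ} (hy : 0 ≤ y) :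
    ∃ x ∈ Ici (0 : ℝ), φ x = y := by
  obtain ⟨x, hx, hφ⟩ := hne
  have hpos : 0 < φ x := lt_of_le_of_ne (h.nonneg hx) hφ.symm
  have hx0 : 0 < x := lt_of_le_of_ne hx fun h0 => hφ (h0 ▸ h.map_zero)
  set k : ℝ := y / φ x + 1 with hk
  have hk1 : 1 ≤ k := by rw [hk]; linarith [div_nonneg hy hpos.le]
  have h1 := h.mul_le_mul hx (le_mul_of_one_le_left hx hk1)
  have h2 : φ x * k ≤ φ (k * x) := by
    refine le_of_mul_le_mul_right ?_ hx0
    linarith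
  have h3 : y ≤ φ (k * x) := by
    refine le_trans ?_ h2
    rw [hk, mul_add, mul_div_cancel₀ _ hpos.ne']
    linarith
  have hkx : 0 ≤ k * x := by positivity
  have := intermediate_value_Icc hkx (h.continuousOn.mono Icc_subset_Ici_self)
  obtain ⟨z, hz, hzy⟩ := this ⟨by rw [h.map_zero]; exact hy, h3⟩
  exact ⟨z, hz.1, hzy⟩

theorem apply_phiInv (h : HypH0 φ) (hne : ∃ x : ℝ, 0 ≤ x ∧ φ x ≠ 0) {y : ℝ} (hy : 0 ≤ y) :
    φ (phiInv φ y) = y :=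
  Function.invFunOn_eq (h.exists_eq hne hy)

theorem phiInv_pos (h : HypH0 φ) (hne : ∃ x : ℝ, 0 ≤ x ∧ φ x ≠ 0) {y : ℝ} (hy : 0 < y) :
    0 < phiInv φ y := by
  refine lt_of_le_of_ne (Function.invFunOn_mem (h.exists_eq hne hy.le)) fun h0 => ?_
  have := h.apply_phiInv hne hy.le
  rw [← h0, h.map_zero] at this
  exact hy.ne this

end HypH0

/-! ### Log-concavity of the radial density -/

/-- The potential of the radial density with exponent `m`. -/
noncomputable def radialPotential (m : ℕ) (φ : ℝ → ℝ) (r : ℝ) : ℝ := φ r - m * Real.log r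

/-- The points of `[0, ∞)` where the radial density with exponent `m` is positive. -/
def radialDomain (m : ℕ) : Set ℝ := {r | 0 ≤ r ∧ (r = 0 → m = 0)}

theorem radialDomain_zero : radialDomain 0 = Ici 0 := by
  ext; simp [radialDomain]

theorem radialDomain_of_ne_zero {m : ℕ} (hm : m ≠ 0) : radialDomain m = Ioi 0 := by
  ext x
  simp only [radialDomain, hm, imp_false, mem_ofPred_eq, mem_Ioi]
  exact ⟨fun h => lt_of_le_of_ne h.1 (Ne.symm h.2), fun h => ⟨h.le, h.ne'⟩⟩

theorem mem_radialDomain_of_pos {m : ℕ} {r : ℝ} (hr : 0 < r) : r ∈ radialDomain m :=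
  ⟨hr.le, fun h => absurd h hr.ne'⟩

theorem mem_radialDomain_of_radialDensity_pos {m : ℕ} {φ : ℝ → ℝ} {r : ℝ} (hr : 0 ≤ r)
    (h : 0 < radialDensity m φ r) : r ∈ radialDomain m := by
  refine ⟨hr, fun h0 => ?_⟩
  by_contra hm
  simp [radialDensity, h0, hm] at h

theorem radialDensity_eq_exp {m : ℕ} (φ : ℝ → ℝ) {r : ℝ} (hr : r ∈ radialDomain m) :
    radialDensity m φ r = Real.exp (-radialPotential m φ r) := by
  rcases hr.1.eq_or_lt with h0 | h0
  · obtain rfl := hr.2 h0.symm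
    simp [radialDensity, radialPotential]
  · rw [radialDensity, radialPotential, neg_sub, sub_eq_add_neg, Real.exp_add, ← Real.log_pow,
      Real.exp_log (pow_pos h0 _)]

theorem radialDensity_eq_zero {m : ℕ} (φ : ℝ → ℝ) {r : ℝ} (hr : 0 ≤ r) (h : r ∉ radialDomain m) :
    radialDensity m φ r = 0 := by
  by_contra hne
  refine h (mem_radialDomain_of_radialDensity_pos hr (lt_of_le_of_ne ?_ (Ne.symm hne)))
  unfold radialDensity; positivity

theorem HypH0.continuousOn_radialDensity {φ : ℝ → ℝ} (h : HypH0 φ) (m : ℕ) :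
    ContinuousOn (radialDensity m φ) (Ici 0) :=
  (continuous_pow m).continuousOn.mul h.continuousOn.neg.rexp

theorem HypH0.convexOn_radialPotential {φ : ℝ → ℝ} (h : HypH0 φ) (m : ℕ) :
    ConvexOn ℝ (radialDomain m) (radialPotential m φ) := by
  rcases eq_or_ne m 0 with rfl | hm
  · rw [radialDomain_zero]
    have : radialPotential 0 φ = φ := by funext; simp [radialPotential]
    rw [this]
    exact h.convexOn
  · rw [radialDomain_of_ne_zero hm]
    have h1 := (h.convexOn.subset Ioi_subset_Ici_self (convex_Ioi 0)).sub
      (strictConcaveOn_log_Ioi.concaveOn.smul (Nat.cast_nonneg m : (0 : ℝ) ≤ m))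
    exact h1

theorem ConvexOn.add_mul_le_of_lt {S : Set ℝ} {V : ℝ → ℝ} (hV : ConvexOn ℝ S V) {p t r k : ℝ}
    (hp : p ∈ S) (hr : r ∈ S) (hpt : p < t) (htr : t < r) (hk : k * (t - p) ≤ V t - V p) :
    V t + k * (r - t) ≤ V r := by
  have h1 := hV.slope_mono_adjacent hp hr hpt htr
  have h2 : k ≤ (V t - V p) / (t - p) := by rwa [le_div_iff₀ (sub_pos.2 hpt)]
  have h3 := (le_div_iff₀ (sub_pos.2 htr)).1 (h2.trans h1)
  linarith

theorem ConvexOn.add_mul_le_of_gt {S : Set ℝ} {V : ℝ → ℝ} (hV : ConvexOn ℝ S V) {p s r k : ℝ}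
    (hp : p ∈ S) (hr : r ∈ S) (hrs : r < s) (hsp : s < p) (hk : k * (p - s) ≤ V s - V p) :
    V s + k * (s - r) ≤ V r := by
  have h1 := hV.slope_mono_adjacent hr hp hrs hsp
  have h2 : (V p - V s) / (p - s) ≤ -k := by
    rw [div_le_iff₀ (sub_pos.2 hsp)]; linarith
  have h3 := (div_le_iff₀ (sub_pos.2 hrs)).1 (h1.trans h2)
  linarith

namespace HypH0

variable {φ : ℝ → ℝ}

/-- Beyond `t` the convex potential keeps growing at least at its secant slope over `[p, t]`, so the
density is dominated by an exponential of rate `k`. -/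
theorem unnormalizedRadialMeasure_Ioi_le (h : HypH0 φ) {m : ℕ} {p t k : ℝ} (hp : p ∈ radialDomain m)
    (hpt : p < t) (hk0 : 0 < k)
    (hk : k * (t - p) ≤ radialPotential m φ t - radialPotential m φ p) :
    unnormalizedRadialMeasure (m + 1) φ (Ioi t) ≤ ENNReal.ofReal (radialDensity m φ t / k) := by
  have ht0 : 0 < t := hp.1.trans_lt hpt
  have hg : 0 ≤ radialDensity m φ t := by unfold radialDensity; positivity
  rw [← lintegral_Ioi_exp hk0 hg t]
  refine unnormalizedRadialMeasure_le measurableSet_Ioi fun r hr _ => ?_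
  have hr' : r ∈ radialDomain m := mem_radialDomain_of_pos (ht0.trans hr)
  rw [radialDensity_eq_exp φ hr', radialDensity_eq_exp φ (mem_radialDomain_of_pos ht0),
    ← Real.exp_add, Real.exp_le_exp]
  have := (h.convexOn_radialPotential m).add_mul_le_of_lt hp hr' hpt hr hk
  linarith

theorem unnormalizedRadialMeasure_Iio_le (h : HypH0 φ) {m : ℕ} {p s k : ℝ} (hp : p ∈ radialDomain m)
    (hs : s ∈ radialDomain m) (hsp : s < p) (hk0 : 0 < k)
    (hk : k * (p - s) ≤ radialPotential m φ s - radialPotential m φ p) :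
    unnormalizedRadialMeasure (m + 1) φ (Iio s) ≤ ENNReal.ofReal (radialDensity m φ s / k) := by
  have hg : 0 ≤ radialDensity m φ s := by
    have := hs.1
    unfold radialDensity; positivity
  rw [← lintegral_Iic_exp hk0 hg s]
  refine (measure_mono Iio_subset_Iic_self).trans
    (unnormalizedRadialMeasure_le measurableSet_Iic fun r hr hr0 => ?_)
  by_cases hr' : r ∈ radialDomain m
  · rcases (mem_Iic.1 hr).eq_or_lt with rfl | hrs
    · simp
    rw [radialDensity_eq_exp φ hr', radialDensity_eq_exp φ hs, ← Real.exp_add, Real.exp_le_exp]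
    have := (h.convexOn_radialPotential m).add_mul_le_of_gt hp hr' hrs hsp hk
    linarith
  · rw [radialDensity_eq_zero φ hr0 hr']
    positivity

theorem le_radialDensity_of_mem_Icc (h : HypH0 φ) {m : ℕ} {s t r c : ℝ} (hs : s ∈ radialDomain m)
    (hr : r ∈ Icc s t) (hcs : c ≤ radialDensity m φ s) (hct : c ≤ radialDensity m φ t) :
    c ≤ radialDensity m φ r := by
  have hmem : ∀ x, s ≤ x → x ∈ radialDomain m := fun x hx =>
    ⟨hs.1.trans hx, fun h0 => hs.2 (le_antisymm (h0 ▸ hx) hs.1)⟩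
  have hst : s ≤ t := hr.1.trans hr.2
  have := (h.convexOn_radialPotential m).le_max_of_mem_Icc hs (hmem t hst) hr
  rw [radialDensity_eq_exp φ hs] at hcs
  rw [radialDensity_eq_exp φ (hmem t hst)] at hct
  rw [radialDensity_eq_exp φ (hmem r hr.1)]
  rcases le_max_iff.1 this with h1 | h1
  · exact hcs.trans (Real.exp_le_exp.2 (by linarith))
  · exact hct.trans (Real.exp_le_exp.2 (by linarith))

end HypH0

/-! ### Growth of the potential away from the mode -/

theorem sq_div_two_add_mono {x y : ℝ} (hx : 0 ≤ x) (hxy : x ≤ y) :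
    x ^ 2 / (2 + x) ≤ y ^ 2 / (2 + y) := by
  rw [div_le_div_iff₀ (by linarith) (by linarith)]
  nlinarith [mul_nonneg hx (hx.trans hxy), mul_nonneg (mul_nonneg hx (hx.trans hxy)) (sub_nonneg.2 hxy),
    mul_nonneg hx (sub_nonneg.2 hxy), mul_nonneg (hx.trans hxy) (sub_nonneg.2 hxy)]

/-- With `u = √x`, `log x ≤ 2 (u - 1)` leaves `x - 1 - log x ≥ (u - 1) ^ 2`, while `(x - 1) ^ 2 / (x
+ 1) ≤ 2 (u - 1) ^ 2`. -/
theorem sq_div_le_sub_one_sub_log {x : ℝ} (hx : 0 < x) :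
    |x - 1| ^ 2 / (2 + |x - 1|) / 2 ≤ x - 1 - Real.log x := by
  set u := Real.sqrt x with hu
  have hu0 : 0 < u := Real.sqrt_pos.2 hx
  have hxu : x = u ^ 2 := (Real.sq_sqrt hx.le).symm
  have hlog : Real.log x ≤ 2 * (u - 1) := by
    rw [hxu, Real.log_pow]
    have := Real.log_le_sub_one_of_pos hu0
    push_cast; linarith
  have h1 : x + 1 ≤ 2 + |x - 1| := by linarith [le_abs_self (x - 1)]
  have h2 : |x - 1| ^ 2 / (2 + |x - 1|) ≤ (x - 1) ^ 2 / (x + 1) := by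
    rw [sq_abs]
    gcongr
  have h3 : (x - 1) ^ 2 / (x + 1) ≤ 2 * (u - 1) ^ 2 := by
    rw [div_le_iff₀ (by linarith), hxu]
    nlinarith [mul_nonneg (sq_nonneg (u - 1)) (sq_nonneg (u - 1))]
  nlinarith

theorem ConvexOn.add_deriv_mul_le {S : Set ℝ} {f : ℝ → ℝ} (hf : ConvexOn ℝ S f) {p r f' : ℝ}
    (hp : p ∈ S) (hr : r ∈ S) (hd : HasDerivAt f f' p) : f p + f' * (r - p) ≤ f r := by
  rcases lt_trichotomy p r with hpr | rfl | hpr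
  · have := hf.le_slope_of_hasDerivAt hp hr hpr hd
    rw [slope_def_field, le_div_iff₀ (sub_pos.2 hpr)] at this
    linarith
  · simp
  · have := hf.slope_le_of_hasDerivAt hr hp hpr hd
    rw [slope_def_field, div_le_iff₀ (sub_pos.2 hpr)] at this
    linarith

namespace HypH0

variable {φ : ℝ → ℝ}

/-- At an interior mode `φ' p = m / p`, so the tangent inequality for `φ` leaves `V r - V p ≥ m (x -
1 - log x)` with `x = r / p`; since `p ≤ R`, the scale `p` may be relaxed to `R`. The loss `-1` is
needed only for `m = 0`, where `φ` may be flat near `0`. -/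
theorem exists_mode (h : HypH0 φ) (m : ℕ) {R : ℝ} (hR : 0 < R) (hφR : φ R = m + 1) :
    ∃ p ∈ radialDomain m, p ≤ R ∧ (m = 0 → p = 0) ∧ ∀ r ∈ radialDomain m,
      ((m : ℝ) + 1) / 4 * ((|r - p| / R) ^ 2 / (2 + |r - p| / R)) - 1
        ≤ radialPotential m φ r - radialPotential m φ p := by
  rcases eq_or_ne m 0 with rfl | hm
  · refine ⟨0, by simp [radialDomain_zero], hR.le, fun _ => rfl, fun r hr => ?_⟩
    have hr0 : 0 ≤ r := hr.1
    simp only [radialPotential, Nat.cast_zero, zero_mul, sub_zero, h.map_zero, zero_add,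
      abs_of_nonneg hr0] at hφR ⊢
    set z := r / R with hz
    have hz0 : 0 ≤ z := by positivity
    have h1 : z ^ 2 / (2 + z) ≤ z := by
      rw [div_le_iff₀ (by linarith)]; nlinarith
    rcases le_total r R with hrR | hrR
    · have : z ≤ 1 := by rwa [hz, div_le_one hR]
      linarith [h.nonneg hr0]
    · have := h.mul_le_mul hR.le hrR
      rw [hφR, one_mul] at this
      have : z ≤ φ r := by rwa [hz, div_le_iff₀ hR]
      linarith
  · have hm1 : (1 : ℝ) ≤ m := by exact_mod_cast Nat.one_le_iff_ne_zero.2 hm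
    obtain ⟨p, hpI, hpmax⟩ := isCompact_Icc.exists_isMaxOn (nonempty_Icc.2 hR.le)
      ((h.continuousOn_radialDensity m).mono Icc_subset_Ici_self)
    have hgR : 0 < radialDensity m φ R := by unfold radialDensity; positivity
    have hpD : p ∈ radialDomain m := mem_radialDomain_of_radialDensity_pos hpI.1
      (hgR.trans_le (hpmax (right_mem_Icc.2 hR.le)))
    have hp0 : 0 < p := by rwa [radialDomain_of_ne_zero hm] at hpD
    have hle : ∀ r, 0 < r → r ≤ R → radialPotential m φ p ≤ radialPotential m φ r := by
      intro r hr hrR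
      have := hpmax ⟨hr.le, hrR⟩
      simp only [mem_ofPred_eq, radialDensity_eq_exp φ hpD,
        radialDensity_eq_exp φ (mem_radialDomain_of_pos hr), Real.exp_le_exp] at this
      linarith
    have hmin : ∀ r, 0 < r → radialPotential m φ p ≤ radialPotential m φ r := by
      intro r hr
      rcases le_total r R with hrR | hrR
      · exact hle r hr hrR
      -- Beyond `R`, `φ r ≥ (m + 1) r / R` outgrows `m log (r / R)`, so the minimum over `(0, R]` is
      -- global.
      · refine (hle R hR le_rfl).trans ?_
        have h1 := h.mul_le_mul hR.le hrR
        rw [hφR] at h1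
        have h2 : ((m : ℝ) + 1) * (r / R) ≤ φ r := by
          rw [← mul_div_assoc, div_le_iff₀ hR]; exact h1
        have h3 := Real.log_le_sub_one_of_pos (div_pos hr hR)
        rw [Real.log_div hr.ne' hR.ne'] at h3
        have h4 : 1 ≤ r / R := by rwa [one_le_div hR]
        have h5 := mul_le_mul_of_nonneg_left h3 (Nat.cast_nonneg m : (0 : ℝ) ≤ m)
        unfold radialPotential
        rw [hφR]
        nlinarith
    have hdφ : HasDerivAt φ (deriv φ p) p :=
      ((h.contDiffOn.differentiableOn (by norm_num)).differentiableAt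
        (Ioi_mem_nhds hp0)).hasDerivAt
    have hdV : HasDerivAt (radialPotential m φ) (deriv φ p - m * p⁻¹) p :=
      hdφ.sub ((Real.hasDerivAt_log hp0.ne').const_mul _)
    have hloc : IsLocalMin (radialPotential m φ) p := by
      filter_upwards [Ioi_mem_nhds hp0] with r hr using hmin r hr
    have hder := hloc.hasDerivAt_eq_zero hdV
    refine ⟨p, hpD, hpI.2, fun h0 => absurd h0 hm, fun r hr => ?_⟩
    have hr0 : 0 < r := by rwa [radialDomain_of_ne_zero hm] at hr
    have htan := h.convexOn.add_deriv_mul_le (mem_Ici.2 hp0.le) (mem_Ici.2 hr0.le) hdφ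
    have hx := sq_div_le_sub_one_sub_log (div_pos hr0 hp0)
    rw [Real.log_div hr0.ne' hp0.ne'] at hx
    have hy : |r - p| / R ≤ |r / p - 1| := by
      have : r / p - 1 = (r - p) / p := by field_simp
      rw [this, abs_div, abs_of_pos hp0]
      have := hpI.2
      gcongr
    have hmono := sq_div_two_add_mono (by positivity) hy
    set w := (|r - p| / R) ^ 2 / (2 + |r - p| / R) with hw
    have hw0 : 0 ≤ w := by positivity
    have h1 : w / 2 ≤ r / p - 1 - (Real.log r - Real.log p) := by linarith
    have h2 := mul_le_mul_of_nonneg_left h1 (Nat.cast_nonneg m : (0 : ℝ) ≤ m)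
    have h3 : deriv φ p * (r - p) = m * (r / p - 1) := by
      rw [sub_eq_zero.1 hder]; field_simp
    have h4 : ((m : ℝ) + 1) / 4 * w ≤ m * (w / 2) := by nlinarith
    unfold radialPotential
    nlinarith

end HypH0

/-- Used with `q = √n`: it turns the growth into a linear bound at scale `R / √n`, uniformly in `n`.
-/
theorem mul_sub_two_le_sq_div {q z : ℝ} (hq : 1 ≤ q) (hz : 0 ≤ z) :
    q * z - 2 ≤ q ^ 2 * (z ^ 2 / (2 + z)) := by
  rw [← mul_div_assoc, le_div_iff₀ (by linarith)]
  have h1 : z ≤ q * z := le_mul_of_one_le_left hz hq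
  rcases le_total (q * z) 2 with h | h
  · nlinarith [mul_nonneg (sub_nonneg.2 h) (by linarith : 0 ≤ 2 + z), sq_nonneg (q * z)]
  · nlinarith [mul_le_mul_of_nonneg_left h1 (sub_nonneg.2 h)]

theorem exp_half_mul_self_mul_sqrt_log_le {a L : ℝ} (ha : 0 < a) (hL : L = Real.log (1 / a)) :
    Real.exp (L / 2) * (a * Real.sqrt L) ≤ 1 := by
  have haL : a = Real.exp (-L) := by
    rw [hL, one_div, Real.log_inv, neg_neg, Real.exp_log ha]
  have h1 : Real.sqrt L ≤ Real.exp (L / 2) := by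
    rw [Real.sqrt_le_left (Real.exp_pos _).le, ← Real.exp_nat_mul]
    push_cast
    rw [mul_div_cancel₀ _ two_ne_zero]
    linarith [Real.add_one_le_exp L]
  calc Real.exp (L / 2) * (a * Real.sqrt L)
      ≤ Real.exp (L / 2) * (Real.exp (-L) * Real.exp (L / 2)) := by rw [haL]; gcongr
    _ = 1 := by rw [← Real.exp_add, ← Real.exp_add]; ring_nf; exact Real.exp_zero

/-- `p` is an approximate mode of the radial density with exponent `m` at scale `R`. -/
def IsRadialMode (m : ℕ) (φ : ℝ → ℝ) (R p : ℝ) : Prop :=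
  ∀ r ∈ radialDomain m, ((m : ℝ) + 1) / 4 * ((|r - p| / R) ^ 2 / (2 + |r - p| / R)) - 1
    ≤ radialPotential m φ r - radialPotential m φ p

namespace IsRadialMode

variable {m : ℕ} {φ : ℝ → ℝ} {R p : ℝ}

theorem linear_le (h : IsRadialMode m φ R p) (hR : 0 < R) {r : ℝ} (hr : r ∈ radialDomain m) :
    Real.sqrt (m + 1) / (4 * R) * |r - p| - 3 / 2
      ≤ radialPotential m φ r - radialPotential m φ p := by
  refine le_trans ?_ (h r hr)
  have hq : 1 ≤ Real.sqrt ((m : ℝ) + 1) := by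
    rw [Real.one_le_sqrt]; linarith [(Nat.cast_nonneg m : (0 : ℝ) ≤ m)]
  have h1 := mul_sub_two_le_sq_div hq (by positivity : 0 ≤ |r - p| / R)
  rw [Real.sq_sqrt (by positivity)] at h1
  have h2 : Real.sqrt (m + 1) / (4 * R) * |r - p| = Real.sqrt (m + 1) * (|r - p| / R) / 4 := by
    field_simp
  linarith

theorem radialDensity_le (h : IsRadialMode m φ R p) (hR : 0 < R) (hp : p ∈ radialDomain m) {r : ℝ}
    (hr0 : 0 ≤ r) : radialDensity m φ r ≤ radialDensity m φ p * Real.exp (3 / 2) *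
      Real.exp (-(Real.sqrt (m + 1) / (4 * R)) * |r - p|) := by
  by_cases hr : r ∈ radialDomain m
  · rw [radialDensity_eq_exp φ hr, radialDensity_eq_exp φ hp, ← Real.exp_add, ← Real.exp_add,
      Real.exp_le_exp]
    linarith [h.linear_le hR hr]
  · rw [radialDensity_eq_zero φ hr0 hr, radialDensity_eq_exp φ hp]
    positivity

theorem unnormalizedRadialMeasure_univ_le (h : IsRadialMode m φ R p) (hR : 0 < R)
    (hp : p ∈ radialDomain m) : unnormalizedRadialMeasure (m + 1) φ univ
      ≤ ENNReal.ofReal (8 * Real.exp (3 / 2) * radialDensity m φ p * (R / Real.sqrt (m + 1))) := by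
  have hn : 0 < Real.sqrt ((m : ℝ) + 1) := Real.sqrt_pos.2 (by positivity)
  set k := Real.sqrt ((m : ℝ) + 1) / (4 * R) with hk
  have hk0 : 0 < k := by positivity
  set c := radialDensity m φ p * Real.exp (3 / 2) with hc
  have hc0 : 0 ≤ c := by rw [hc, radialDensity_eq_exp φ hp]; positivity
  have h1 : unnormalizedRadialMeasure (m + 1) φ (Iic p) ≤ ENNReal.ofReal (c / k) := by
    rw [← lintegral_Iic_exp hk0 hc0 p]
    refine unnormalizedRadialMeasure_le measurableSet_Iic fun r hr hr0 => ?_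
    have := h.radialDensity_le hR hp hr0
    rwa [abs_sub_comm, abs_of_nonneg (sub_nonneg.2 hr)] at this
  have h2 : unnormalizedRadialMeasure (m + 1) φ (Ioi p) ≤ ENNReal.ofReal (c / k) := by
    rw [← lintegral_Ioi_exp hk0 hc0 p]
    refine unnormalizedRadialMeasure_le measurableSet_Ioi fun r hr hr0 => ?_
    have := h.radialDensity_le hR hp hr0
    rwa [abs_of_nonneg (sub_nonneg.2 (le_of_lt hr))] at this
  rw [← Iic_union_Ioi (a := p)]
  refine (measure_union_le _ _).trans ((add_le_add h1 h2).trans_eq ?_)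
  rw [← ENNReal.ofReal_add (by positivity) (by positivity)]
  congr 1
  rw [hk, hc]
  field_simp
  ring

/-- Near an approximate mode, the slope of the potential between the mode and a point of low
density is large. -/
theorem mul_abs_sub_le (h : IsRadialMode m φ R p) (hR : 0 < R) {x a L κ : ℝ}
    (ha : 0 ≤ a) (hL : 0 ≤ L) (hx : x ∈ radialDomain m)
    (hκ : κ ≤ 1 / 300 * (Real.sqrt (m + 1) / R) * (a * Real.sqrt L))
    (hD : L / 2 + 2 ≤ radialPotential m φ x - radialPotential m φ p) (hxp : |x - p| ≤ 8 * R) :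
    κ * |x - p| ≤ a / 8 * (radialPotential m φ x - radialPotential m φ p) := by
  have hb := h x hx
  set D := radialPotential m φ x - radialPotential m φ p with hDdef
  set z := |x - p| / R with hz
  have hz0 : 0 ≤ z := by positivity
  have hz8 : z ≤ 8 := by rwa [hz, div_le_iff₀ hR]
  have hxz : |x - p| = z * R := by rw [hz]; field_simp
  have hn : (0 : ℝ) ≤ (m : ℝ) + 1 := by positivity
  have h1 : z ^ 2 / 10 ≤ z ^ 2 / (2 + z) := by gcongr; linarith
  -- From `n z ^ 2 / 40 - 1 ≤ D` and `D ≥ 2`. With `L ≤ 2 D` this gives `n z ^ 2 L ≤ 120 D ^ 2 ≤ (11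
  -- D) ^ 2`.
  have h2 : ((m : ℝ) + 1) * z ^ 2 ≤ 60 * D := by nlinarith
  have h3 : Real.sqrt (m + 1) * z * Real.sqrt L ≤ 11 * D := by
    refine abs_le_of_sq_le_sq' ?_ (by linarith) |>.2
    rw [mul_pow, mul_pow, Real.sq_sqrt hn, Real.sq_sqrt hL]
    have : ((m : ℝ) + 1) * z ^ 2 * L ≤ 60 * D * (2 * D) := by
      gcongr
      · linarith
      · linarith
    nlinarith [sq_nonneg D]
  calc κ * |x - p| ≤ 1 / 300 * (Real.sqrt (m + 1) / R) * (a * Real.sqrt L) * |x - p| := by gcongr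
    _ = a / 300 * (Real.sqrt (m + 1) * z * Real.sqrt L) := by rw [hxz]; field_simp
    _ ≤ a / 300 * (11 * D) := by gcongr
    _ ≤ a / 8 * D := by nlinarith

end IsRadialMode

/-- A density level below the claimed isoperimetric bound is far below the maximum. -/
theorem exp_mul_level_le {q R a L κ Z M : ℝ} (hq : 0 < q) (hR : 0 < R) (ha : 0 < a)
    (hM : 0 < M) (hL : L = Real.log (1 / a))
    (hκ : κ ≤ 1 / 300 * (q / R) * (a * Real.sqrt L)) (hZ0 : 0 ≤ Z)
    (hZ : Z ≤ 8 * Real.exp (3 / 2) * M * (R / q)) :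
    Real.exp (L / 2 + 2) * (κ * Z) ≤ M := by
  have h1 := exp_half_mul_self_mul_sqrt_log_le ha hL
  -- The constant `1 / 300` is chosen so that `8 e ^ (7 / 2) ≤ 300`.
  have h2 : Real.exp 2 * Real.exp (3 / 2) ≤ 300 / 8 := by
    rw [← Real.exp_add]
    have h3 : Real.exp (2 + 3 / 2) ^ 2 = Real.exp 1 ^ 7 := by
      rw [← Real.exp_nat_mul, ← Real.exp_nat_mul]; norm_num
    have h4 : Real.exp 1 ^ 7 ≤ (2.72 : ℝ) ^ 7 := by
      gcongr; linarith [Real.exp_one_lt_d9]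
    refine abs_le_of_sq_le_sq' ?_ (by norm_num) |>.2
    rw [h3]
    exact h4.trans (by norm_num)
  have h0 : 0 ≤ a * Real.sqrt L := by positivity
  calc Real.exp (L / 2 + 2) * (κ * Z)
      ≤ Real.exp (L / 2 + 2) * ((1 / 300 * (q / R) * (a * Real.sqrt L)) *
          (8 * Real.exp (3 / 2) * M * (R / q))) := by gcongr
    _ = 8 / 300 * (Real.exp 2 * Real.exp (3 / 2)) * (Real.exp (L / 2) * (a * Real.sqrt L)) * M := by
        rw [Real.exp_add]; field_simp
    _ ≤ 8 / 300 * (300 / 8) * 1 * M := by gcongr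
    _ = M := by ring

theorem two_mul_one_add_log_le {u : ℝ} (hu : 8 ≤ u) : 2 * (1 + Real.log u) ≤ u := by
  have h1 := Real.log_le_sub_one_of_pos (by linarith : 0 < u / 8)
  have h2 : Real.log u = Real.log (u / 8) + 3 * Real.log 2 := by
    rw [Real.log_div (by linarith) (by norm_num), show (8 : ℝ) = 2 ^ 3 by norm_num, Real.log_pow]
    push_cast; ring
  linarith [Real.log_two_lt_d9]

/-! ### Tails outside a level set of the density -/

namespace HypH0

variable {φ : ℝ → ℝ}

/-- With `u = t / R ≥ 8`, what is subtracted from `φ t` is at most `n (1 + log u) ≤ n u / 2 ≤ φ t /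
2`. -/
theorem half_le_radialPotential_sub (h : HypH0 φ) {m : ℕ} {R t : ℝ} (hR : 0 < R)
    (hφR : φ R = m + 1) (ht : 8 * R ≤ t) :
    φ t / 2 ≤ radialPotential m φ t - radialPotential m φ R := by
  have ht0 : 0 < t := by linarith
  have hu : 8 ≤ t / R := by rwa [le_div_iff₀ hR]
  have h1 := two_mul_one_add_log_le hu
  have h2 := h.mul_le_mul hR.le (by linarith : R ≤ t)
  rw [hφR] at h2
  have h3 : ((m : ℝ) + 1) * (t / R) ≤ φ t := by
    rw [← mul_div_assoc, div_le_iff₀ hR]; exact h2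
  have h4 : 0 ≤ Real.log (t / R) := Real.log_nonneg (by linarith)
  have h5 : Real.log (t / R) = Real.log t - Real.log R := Real.log_div ht0.ne' hR.ne'
  have hm : (0 : ℝ) ≤ m := Nat.cast_nonneg m
  unfold radialPotential
  rw [hφR]
  nlinarith

theorem exists_unnormalizedRadialMeasure_univ_eq (h : HypH0 φ) {m : ℕ} {R p : ℝ} (hR : 0 < R)
    (hp : p ∈ radialDomain m) (hmode : IsRadialMode m φ R p) : ∃ Z, 0 < Z ∧
      Z ≤ 8 * Real.exp (3 / 2) * radialDensity m φ p * (R / Real.sqrt (m + 1)) ∧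
      unnormalizedRadialMeasure (m + 1) φ univ = ENNReal.ofReal Z := by
  have hle := hmode.unnormalizedRadialMeasure_univ_le hR hp
  have hfin : unnormalizedRadialMeasure (m + 1) φ univ ≠ ∞ := ne_top_of_le_ne_top
    ENNReal.ofReal_ne_top hle
  have hc : 0 < 1 * Real.exp (-φ 2) := by positivity
  have hlow := ofReal_mul_sub_le_unnormalizedRadialMeasure_Ioo (m := m) (φ := φ) (x := 1) (y := 2)
    zero_le_one hc.le fun r hr => by
      have hr0 : 0 ≤ r := by linarith [hr.1]
      have h1 : (1 : ℝ) ≤ r ^ m := one_le_pow₀ hr.1.le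
      have h2 : φ r ≤ φ 2 := h.monotoneOn hr0 (by norm_num : (0 : ℝ) ≤ 2) hr.2.le
      unfold radialDensity
      gcongr
  have hpos : unnormalizedRadialMeasure (m + 1) φ univ ≠ 0 := by
    refine (lt_of_lt_of_le ?_ (hlow.trans (measure_mono (subset_univ _)))).ne'
    rw [ENNReal.ofReal_pos]
    linarith
  refine ⟨_, ENNReal.toReal_pos hpos hfin, ?_, (ENNReal.ofReal_toReal hfin).symm⟩
  refine ENNReal.toReal_le_of_le_ofReal ?_ hle
  rw [radialDensity_eq_exp φ hp]
  positivity

end HypH0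

theorem le_radialPotential_sub_of_exp_mul_le {m : ℕ} {φ : ℝ → ℝ} {p x γ c : ℝ}
    (hp : p ∈ radialDomain m) (hx : x ∈ radialDomain m) (hxγ : radialDensity m φ x = γ)
    (h : Real.exp c * γ ≤ radialDensity m φ p) :
    c ≤ radialPotential m φ x - radialPotential m φ p := by
  rw [← hxγ, radialDensity_eq_exp φ hx, radialDensity_eq_exp φ hp, ← Real.exp_add,
    Real.exp_le_exp] at h
  linarith

namespace HypH0

variable {φ : ℝ → ℝ}

theorem exists_gt_radialDensity_eq (h : HypH0 φ) {m : ℕ} {R p γ : ℝ} (hR : 0 < R)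
    (hp : p ∈ radialDomain m) (hmode : IsRadialMode m φ R p) (hγ : 0 < γ)
    (hγp : γ < radialDensity m φ p) : ∃ t, p < t ∧ radialDensity m φ t = γ := by
  have hn : 0 < Real.sqrt ((m : ℝ) + 1) := Real.sqrt_pos.2 (by positivity)
  set k := Real.sqrt ((m : ℝ) + 1) / (4 * R) with hk
  have hk0 : 0 < k := by positivity
  set B := |-Real.log γ - radialPotential m φ p| + 3 / 2 with hB
  have hB0 : 0 < B := by positivity
  have hBk : 0 < B / k := by positivity
  have ht1 : p + B / k ∈ radialDomain m := mem_radialDomain_of_pos (by linarith [hp.1])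
  have h1 := hmode.linear_le hR ht1
  rw [← hk, add_sub_cancel_left, abs_of_pos hBk, mul_div_cancel₀ _ hk0.ne'] at h1
  have h2 : radialDensity m φ (p + B / k) ≤ γ := by
    rw [radialDensity_eq_exp φ ht1, ← Real.le_log_iff_exp_le hγ]
    linarith [le_abs_self (-Real.log γ - radialPotential m φ p)]
  obtain ⟨t, ht, htγ⟩ := intermediate_value_Icc' (by linarith : p ≤ p + B / k)
    ((h.continuousOn_radialDensity m).mono fun x hx => hp.1.trans hx.1) ⟨h2, hγp.le⟩
  refine ⟨t, lt_of_le_of_ne ht.1 fun h0 => ?_, htγ⟩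
  rw [← h0] at htγ
  linarith

theorem radialMeasure_Ioi_le (h : HypH0 φ) {m : ℕ} {R p a L κ Z t : ℝ} (hR : 0 < R)
    (hφR : φ R = m + 1) (hp : p ∈ radialDomain m)
    (hmode : IsRadialMode m φ R p) (hZ0 : 0 < Z)
    (hZ : unnormalizedRadialMeasure (m + 1) φ univ = ENNReal.ofReal Z)
    (ha : 0 < a) (hL : 0 ≤ L)
    (hκ1 : κ ≤ 1 / 300 * (Real.sqrt (m + 1) / R) * (a * Real.sqrt L))
    (hκ2 : ∀ t, R ≤ t → L / 2 ≤ φ t → κ * t ≤ a / 8 * φ t)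
    (hpt : p < t) (ht : radialDensity m φ t = κ * Z)
    (hD : L / 2 + 2 ≤ radialPotential m φ t - radialPotential m φ p) :
    radialMeasure (m + 1) φ (Ioi t) ≤ ENNReal.ofReal (a / 4) := by
  have ht0 : 0 < t := hp.1.trans_lt hpt
  suffices H : ∃ k, 0 < k ∧ κ / k ≤ a / 4 ∧
      unnormalizedRadialMeasure (m + 1) φ (Ioi t) ≤ ENNReal.ofReal (κ * Z / k) by
    obtain ⟨k, hk0, hk, hle⟩ := H
    rw [radialMeasure_apply hZ0 hZ]
    calc _ ≤ ENNReal.ofReal Z⁻¹ * ENNReal.ofReal (κ * Z / k) := by gcongr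
      _ = ENNReal.ofReal (κ / k) := by
        rw [← ENNReal.ofReal_mul (by positivity)]
        congr 1
        field_simp
      _ ≤ _ := ENNReal.ofReal_le_ofReal hk
  -- Near the mode the slope is taken from `p`, and `hκ1` suffices; far away it is taken from `R`,
  -- where `V R` is explicit, and `hκ2` is used.
  rcases le_or_gt (t - p) (8 * R) with htp | htp
  · set D := radialPotential m φ t - radialPotential m φ p with hDdef
    have hD0 : 0 < D := by linarith
    have htp0 : 0 < t - p := sub_pos.2 hpt
    refine ⟨D / (t - p), by positivity, ?_, ?_⟩
    · have := hmode.mul_abs_sub_le hR ha.le hL (mem_radialDomain_of_pos ht0) hκ1 hD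
        (by rwa [abs_of_pos htp0])
      rw [abs_of_pos htp0] at this
      rw [div_div_eq_mul_div, div_le_iff₀ hD0]
      nlinarith
    · rw [← ht]
      refine h.unnormalizedRadialMeasure_Ioi_le hp hpt (by positivity) ?_
      rw [div_mul_cancel₀ _ htp0.ne']
  · have ht8 : 8 * R ≤ t := by linarith [hp.1]
    have hφt : L / 2 + 2 ≤ φ t := by
      refine hD.trans ?_
      have h1 := h.nonneg hp.1
      have h2 : (m : ℝ) * Real.log p ≤ m * Real.log t := by
        rcases eq_or_ne m 0 with rfl | hm
        · simp
        · rw [radialDomain_of_ne_zero hm] at hp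
          have := Real.log_le_log hp hpt.le
          gcongr
      unfold radialPotential
      linarith
    have hφ0 : 0 < φ t := by linarith
    refine ⟨φ t / (2 * t), by positivity, ?_, ?_⟩
    · have := hκ2 t (by linarith) (by linarith)
      rw [div_div_eq_mul_div, div_le_iff₀ hφ0]
      linarith
    · rw [← ht]
      refine h.unnormalizedRadialMeasure_Ioi_le (mem_radialDomain_of_pos hR) (by linarith)
        (by positivity) (le_trans ?_ (h.half_le_radialPotential_sub hR hφR ht8))
      calc φ t / (2 * t) * (t - R) ≤ φ t / (2 * t) * t := by gcongr; linarith
        _ = φ t / 2 := by field_simp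

theorem exists_radialMeasure_Iio_le (h : HypH0 φ) {m : ℕ} {R p a L κ Z : ℝ} (hR : 0 < R)
    (hp : p ∈ radialDomain m) (hp0 : m = 0 → p = 0) (hpR : p ≤ R)
    (hmode : IsRadialMode m φ R p) (hZ0 : 0 < Z)
    (hZ : unnormalizedRadialMeasure (m + 1) φ univ = ENNReal.ofReal Z)
    (ha : 0 < a) (hL : 0 ≤ L) (hκ : 0 < κ)
    (hκ1 : κ ≤ 1 / 300 * (Real.sqrt (m + 1) / R) * (a * Real.sqrt L))
    (hlev : Real.exp (L / 2 + 2) * (κ * Z) ≤ radialDensity m φ p)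
    (hlt : κ * Z < radialDensity m φ p) :
    ∃ s ∈ radialDomain m, s ≤ p ∧ κ * Z ≤ radialDensity m φ s ∧
      radialMeasure (m + 1) φ (Iio s) ≤ ENNReal.ofReal (a / 4) := by
  have hγ : 0 < κ * Z := by positivity
  -- For `m = 0` the mode is the endpoint `0` and there is no left tail. Otherwise the density
  -- vanishes at `0`, so the level is attained left of `p`, at distance at most `p ≤ R`: no far case
  -- arises.
  rcases eq_or_ne m 0 with rfl | hm
  · obtain rfl := hp0 rfl
    refine ⟨0, hp, le_rfl, hlt.le, ?_⟩
    have : unnormalizedRadialMeasure (0 + 1) φ (Iio 0) = 0 := by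
      rw [unnormalizedRadialMeasure_apply 0 φ measurableSet_Iio, Iio_inter_Ici, Ico_self,
        Measure.restrict_empty, lintegral_zero_measure]
    rw [radialMeasure_apply hZ0 hZ, this, mul_zero]
    exact zero_le
  · have hg0 : radialDensity m φ 0 = 0 := by simp [radialDensity, hm]
    obtain ⟨s, hs, hsγ⟩ := intermediate_value_Icc hp.1
      ((h.continuousOn_radialDensity m).mono Icc_subset_Ici_self)
      ⟨hg0.le.trans hγ.le, hlt.le⟩
    have hsD : s ∈ radialDomain m :=
      mem_radialDomain_of_radialDensity_pos hs.1 (by rw [hsγ]; exact hγ)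
    have hsp : s < p := lt_of_le_of_ne hs.2 fun h0 => by rw [h0] at hsγ; linarith
    have hD := le_radialPotential_sub_of_exp_mul_le hp hsD hsγ hlev
    refine ⟨s, hsD, hs.2, hsγ.ge, ?_⟩
    have hps : 0 < p - s := sub_pos.2 hsp
    have habs : |s - p| = p - s := by rw [abs_sub_comm, abs_of_pos hps]
    have hmul := hmode.mul_abs_sub_le hR ha.le hL hsD hκ1 hD (by rw [habs]; linarith [hs.1])
    rw [habs] at hmul
    set D := radialPotential m φ s - radialPotential m φ p with hDdef
    have hD0 : 0 < D := by linarith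
    have hle := h.unnormalizedRadialMeasure_Iio_le hp hsD hsp (k := D / (p - s)) (by positivity)
      (by rw [div_mul_cancel₀ _ hps.ne'])
    rw [radialMeasure_apply hZ0 hZ]
    rw [hsγ] at hle
    calc _ ≤ ENNReal.ofReal Z⁻¹ * ENNReal.ofReal (κ * Z / (D / (p - s))) := by gcongr
      _ = ENNReal.ofReal (κ * (p - s) / D) := by
        rw [← ENNReal.ofReal_mul (by positivity)]
        congr 1
        field_simp
      _ ≤ _ := by
        refine ENNReal.ofReal_le_ofReal ?_
        rw [div_le_iff₀ hD0]
        nlinarith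

/-- A level `κ` is below the isoperimetric function at `a` as soon as it is below the Gaussian-type
bound and the potential satisfies the corresponding growth condition at infinity. -/
theorem ofReal_le_isoperimetricFunction (h : HypH0 φ) {m : ℕ} {R a L κ : ℝ} (hR : 0 < R)
    (hφR : φ R = m + 1) (ha : 0 < a) (ha2 : a ≤ 1 / 2) (hL : L = Real.log (1 / a)) (hκ : 0 < κ)
    (hκ1 : κ ≤ 1 / 300 * (Real.sqrt (m + 1) / R) * (a * Real.sqrt L))
    (hκ2 : ∀ t, R ≤ t → L / 2 ≤ φ t → κ * t ≤ a / 8 * φ t) :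
    ENNReal.ofReal κ ≤ isoperimetricFunction (radialMeasure (m + 1) φ) (ENNReal.ofReal a) := by
  have hL0 : 0 ≤ L := by
    rw [hL]; exact Real.log_nonneg (by rw [one_le_div ha]; linarith)
  have hn : 0 < Real.sqrt ((m : ℝ) + 1) := Real.sqrt_pos.2 (by positivity)
  obtain ⟨p, hp, hpR, hp0, hmode⟩ := h.exists_mode m hR hφR
  obtain ⟨Z, hZ0, hZle, hZ⟩ := h.exists_unnormalizedRadialMeasure_univ_eq hR hp hmode
  have hM : 0 < radialDensity m φ p := by rw [radialDensity_eq_exp φ hp]; positivity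
  have hlev := exp_mul_level_le hn hR ha hM hL hκ1 hZ0.le hZle
  have hγ : 0 < κ * Z := by positivity
  have hlt : κ * Z < radialDensity m φ p :=
    (lt_mul_of_one_lt_left hγ (Real.one_lt_exp_iff.2 (by linarith))).trans_le hlev
  obtain ⟨t, hpt, ht⟩ := h.exists_gt_radialDensity_eq hR hp hmode hγ hlt
  have htD : t ∈ radialDomain m := mem_radialDomain_of_pos (hp.1.trans_lt hpt)
  have hright := h.radialMeasure_Ioi_le hR hφR hp hmode hZ0 hZ ha hL0 hκ1 hκ2 hpt ht
    (le_radialPotential_sub_of_exp_mul_le hp htD ht hlev)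
  obtain ⟨s, hsD, hsp, hs, hleft⟩ := h.exists_radialMeasure_Iio_le hR hp hp0 hpR hmode hZ0 hZ ha hL0
    hκ hκ1 hlev hlt
  have huniv : radialMeasure (m + 1) φ univ = 1 := by
    rw [radialMeasure_apply hZ0 hZ, hZ, ← ENNReal.ofReal_mul (by positivity),
      inv_mul_cancel₀ hZ0.ne', ENNReal.ofReal_one]
  have : IsProbabilityMeasure (radialMeasure (m + 1) φ) := ⟨huniv⟩
  have hsum : radialMeasure (m + 1) φ (Iio s) + radialMeasure (m + 1) φ (Ioi t)
      ≤ ENNReal.ofReal (a / 2) := by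
    refine (add_le_add hleft hright).trans_eq ?_
    rw [← ENNReal.ofReal_add (by positivity) (by positivity)]
    congr 1; ring
  refine le_iInf fun A => le_iInf fun _ => le_iInf fun hA => ?_
  refine ofReal_le_boundaryMeasure (s := s) (t := t) ?_ ?_ ?_
  · rw [hA]
    exact hsum.trans_lt ((ENNReal.ofReal_lt_ofReal_iff ha).2 (by linarith))
  -- Here `a ≤ 1 / 2` enters: `a + a / 2 ≤ 3 / 4 < 1`.
  · rw [hA, huniv, ← ENNReal.ofReal_one]
    refine (add_le_add le_rfl hsum).trans_lt ?_
    rw [← ENNReal.ofReal_add (by positivity) (by positivity),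
      ENNReal.ofReal_lt_ofReal_iff one_pos]
    linarith
  · intro x y hsx _ hyt
    have := ofReal_mul_sub_le_unnormalizedRadialMeasure_Ioo (m := m) (φ := φ) (x := x) (y := y)
      (hsD.1.trans hsx) hγ.le fun r hr => h.le_radialDensity_of_mem_Icc hsD
        ⟨hsx.trans hr.1.le, hr.2.le.trans hyt⟩ hs ht.ge
    rw [radialMeasure_apply hZ0 hZ]
    refine le_trans (le_of_eq ?_) (mul_le_mul_right this _)
    rw [← ENNReal.ofReal_mul (by positivity)]
    congr 1
    field_simp

end HypH0

/-! ### The growth conditions under (H1) and (H2) -/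

theorem half_lt_log_one_div {a : ℝ} (ha : 0 < a) (ha2 : a ≤ 1 / 2) :
    1 / 2 < Real.log (1 / a) := by
  have h1 : (2 : ℝ) ≤ 1 / a := by rw [le_div_iff₀ ha]; linarith
  have h2 := Real.log_le_log two_pos h1
  linarith [Real.log_two_gt_d9]

namespace HypH1

variable {φ : ℝ → ℝ}

/-- (H1) compared at `φ⁻¹(1) ≤ φ⁻¹(y)`. For `y = n` it shows that the dimensional factor `√n φ⁻¹(1)
/ φ⁻¹(n)` is at most `1`. -/
theorem phiInv_one_mul_sqrt_le (h : HypH1 φ) (hne : ∃ x : ℝ, 0 ≤ x ∧ φ x ≠ 0) {y : ℝ}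
    (hy : 1 ≤ y) : phiInv φ 1 * Real.sqrt y ≤ phiInv φ y := by
  have h0 := h.toHypH0
  have h1 := h0.phiInv_pos hne one_pos
  have hy0 := h0.phiInv_pos hne (by linarith : 0 < y)
  have e1 := h0.apply_phiInv hne zero_le_one
  have ey := h0.apply_phiInv hne (by linarith : 0 ≤ y)
  have hle : phiInv φ 1 ≤ phiInv φ y := by
    by_contra! hlt
    have := h0.mul_le_mul hy0.le hlt.le
    rw [e1, ey] at this
    nlinarith
  have := h.antitoneOn_sqrt_div h1 hy0 hle
  simp only [e1, ey, Real.sqrt_one] at this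
  rw [div_le_div_iff₀ hy0 h1] at this
  linarith

/-- For `y = L` this puts the bound in (i) below twice the Gaussian-type one. For `y < 1`, where
(H1) points the wrong way, convexity and `√y ≥ 1 / 2` replace it. -/
theorem phiInv_one_mul_le (h : HypH1 φ) (hne : ∃ x : ℝ, 0 ≤ x ∧ φ x ≠ 0) {y : ℝ}
    (hy : 1 / 2 < y) : phiInv φ 1 * y ≤ 2 * Real.sqrt y * phiInv φ y := by
  have h0 := h.toHypH0
  have h1 := h0.phiInv_pos hne one_pos
  have hypos : 0 < y := by linarith
  have hy0 := h0.phiInv_pos hne hypos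
  have hs : Real.sqrt y * Real.sqrt y = y := Real.mul_self_sqrt hypos.le
  have hs0 : 0 < Real.sqrt y := Real.sqrt_pos.2 hypos
  rcases le_total 1 y with hy1 | hy1
  · have := h.phiInv_one_mul_sqrt_le hne hy1
    nlinarith [mul_le_mul_of_nonneg_left this hs0.le, mul_pos hs0 hy0]
  · have e1 := h0.apply_phiInv hne zero_le_one
    have ey := h0.apply_phiInv hne hypos.le
    have hstar : phiInv φ 1 * y ≤ phiInv φ y := by
      rcases le_total (phiInv φ y) (phiInv φ 1) with hle | hle
      · have := h0.mul_le_mul hy0.le hle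
        rw [e1, ey] at this
        linarith
      · nlinarith
    have : 1 / 2 ≤ Real.sqrt y := Real.le_sqrt_of_sq_le (by linarith)
    nlinarith

theorem div_phiInv_mul_le (h : HypH1 φ) (hne : ∃ x : ℝ, 0 ≤ x ∧ φ x ≠ 0) {y t : ℝ}
    (hy : 0 < y) (ht : 0 ≤ t) (hyt : y / 2 ≤ φ t) : y * t ≤ 2 * φ t * phiInv φ y := by
  have h0 := h.toHypH0
  have hy0 := h0.phiInv_pos hne hy
  have ey := h0.apply_phiInv hne hy.le
  rcases le_total t (phiInv φ y) with hle | hle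
  · nlinarith
  · have := h0.mul_le_mul hy0.le hle
    rw [ey] at this
    nlinarith [mul_nonneg (h0.nonneg ht) hy0.le]

end HypH1

theorem HypH2.sqrt_mul_le {φ : ℝ → ℝ} (h : HypH2 φ) {x y : ℝ} (hx : 0 < x) (hxy : x ≤ y) :
    Real.sqrt (φ x) * y ≤ Real.sqrt (φ y) * x := by
  have := h.monotoneOn_sqrt_div hx (hx.trans_le hxy) hxy
  simp only at this
  rwa [div_le_div_iff₀ hx (hx.trans_le hxy)] at this

theorem theorem5 :
    ∃ C : ℝ, 0 < C ∧
      ∀ n : ℕ, 1 ≤ n → ∀ a : ℝ, a ∈ Set.Icc (0 : ℝ) (1 / 2) →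
        ∀ φ : ℝ → ℝ, (∃ x : ℝ, 0 ≤ x ∧ φ x ≠ 0) →
          (HypH1 φ →
            ENNReal.ofReal (C * (Real.sqrt (n : ℝ) / phiInv φ (n : ℝ)) * phiInv φ 1 *
                (a * Real.log (1 / a) / phiInv φ (Real.log (1 / a))))
              ≤ isoperimetricFunction (radialMeasure n φ) (ENNReal.ofReal a)) ∧
          (HypH2 φ →
            ENNReal.ofReal (C * (Real.sqrt (n : ℝ) / phiInv φ (n : ℝ)) *
                (a * Real.sqrt (Real.log (1 / a))))
              ≤ isoperimetricFunction (radialMeasure n φ) (ENNReal.ofReal a)) := by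
  -- Half of `1 / 300`, to absorb the factor `2` of `phiInv_one_mul_le`.
  refine ⟨1 / 600, by norm_num, fun n hn a ha φ hne => ?_⟩
  rcases ha.1.eq_or_lt with rfl | ha0
  · simp
  obtain ⟨m, rfl⟩ := Nat.exists_eq_add_of_le' hn
  have hL := half_lt_log_one_div ha0 ha.2
  set L := Real.log (1 / a) with hLdef
  have hL0 : 0 < L := by linarith
  have hs0 : 0 < Real.sqrt L := Real.sqrt_pos.2 hL0
  have hsL : Real.sqrt L * Real.sqrt L = L := Real.mul_self_sqrt hL0.le
  have hn0 : (0 : ℝ) < ((m + 1 : ℕ) : ℝ) := by positivity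
  have hn1 : (1 : ℝ) ≤ ((m + 1 : ℕ) : ℝ) := by exact_mod_cast hn
  have hq0 : 0 < Real.sqrt ((m + 1 : ℕ) : ℝ) := Real.sqrt_pos.2 hn0
  have hcast : ((m + 1 : ℕ) : ℝ) = (m : ℝ) + 1 := by push_cast; ring
  constructor
  · intro h
    have h0 := h.toHypH0
    have hR := h0.phiInv_pos hne hn0
    have hφR := h0.apply_phiInv hne hn0.le
    have hI1 := h0.phiInv_pos hne one_pos
    have hIL := h0.phiInv_pos hne hL0
    have hRI := h.phiInv_one_mul_sqrt_le hne hn1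
    have hIsq := h.phiInv_one_mul_le hne hL
    have hgrow := fun t ht => h.div_phiInv_mul_le hne (t := t) hL0 ht
    rw [hcast] at hR hφR hRI hq0 ⊢
    set q := Real.sqrt ((m : ℝ) + 1) with hq
    set R := phiInv φ ((m : ℝ) + 1) with hRdef
    refine h0.ofReal_le_isoperimetricFunction hR hφR ha0 ha.2 hLdef (by positivity) ?_ ?_
    · calc 1 / 600 * (q / R) * phiInv φ 1 * (a * L / phiInv φ L)
          = 1 / 600 * (q / R) * a * (phiInv φ 1 * L / phiInv φ L) := by ring
        _ ≤ 1 / 600 * (q / R) * a * (2 * Real.sqrt L) := by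
          gcongr
          rwa [div_le_iff₀ hIL]
        _ = _ := by ring
    · intro t hRt hLt
      have ht0 : 0 < t := hR.trans_le hRt
      have hφt := h0.nonneg ht0.le
      have e1 : q / R * phiInv φ 1 ≤ 1 := by
        rw [div_mul_eq_mul_div, div_le_one hR]; linarith
      have e2 : L * t / phiInv φ L ≤ 2 * φ t := by
        rw [div_le_iff₀ hIL]
        exact hgrow t ht0.le hLt
      calc 1 / 600 * (q / R) * phiInv φ 1 * (a * L / phiInv φ L) * t
          = 1 / 600 * a * (q / R * phiInv φ 1) * (L * t / phiInv φ L) := by ring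
        _ ≤ 1 / 600 * a * 1 * (2 * φ t) := by gcongr
        _ ≤ a / 8 * φ t := by nlinarith [mul_nonneg ha0.le hφt]
  · intro h
    have h0 := h.toHypH0
    have hR := h0.phiInv_pos hne hn0
    have hφR := h0.apply_phiInv hne hn0.le
    rw [hcast] at hR hφR hq0 ⊢
    set q := Real.sqrt ((m : ℝ) + 1) with hq
    set R := phiInv φ ((m : ℝ) + 1) with hRdef
    refine h0.ofReal_le_isoperimetricFunction hR hφR ha0 ha.2 hLdef (by positivity) ?_ ?_
    · have : 0 ≤ q / R * (a * Real.sqrt L) := by positivity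
      nlinarith
    · intro t hRt hLt
      have ht0 : 0 < t := hR.trans_le hRt
      have e1 := h.sqrt_mul_le hR hRt
      rw [hφR, ← hq] at e1
      -- (H2) between `R` and `t`, with `φ R = n`; together with `L ≤ 2 φ t` it bounds `κ * t` by a
      -- multiple of `a * φ t`.
      have e2 : q / R * t ≤ Real.sqrt (φ t) := by
        rw [div_mul_eq_mul_div, div_le_iff₀ hR]; exact e1
      have e3 : Real.sqrt L ≤ 2 * Real.sqrt (φ t) := by
        rw [Real.sqrt_le_left (by positivity), mul_pow, Real.sq_sqrt (h0.nonneg ht0.le)]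
        linarith
      have e4 : Real.sqrt (φ t) * Real.sqrt (φ t) = φ t := Real.mul_self_sqrt (h0.nonneg ht0.le)
      calc 1 / 600 * (q / R) * (a * Real.sqrt L) * t
          = 1 / 600 * a * (q / R * t) * Real.sqrt L := by ring
        _ ≤ 1 / 600 * a * Real.sqrt (φ t) * (2 * Real.sqrt (φ t)) := by gcongr
        _ = 1 / 300 * a * φ t := by linear_combination 1 / 300 * a * e4
        _ ≤ a / 8 * φ t := by nlinarith [mul_nonneg ha0.le (h0.nonneg ht0.le)]
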